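/- Let $l,w\ge 1$ be integers and $n=lw$. A hammock network $H_{(l,w)}$ of length $l$ and width $w$ is the following brick-wall two-terminal network with $n$ devices. It has $w$ rows ($0\le i<w$) of $l$ devices in series; the device $(i,j)$, $0\le j<l$, joins the points $(i,j)$ and $(i,j+1)$. All points of column $0$ form the source and all points of column $l$ form the sink. In the interior columns $0<j<l$ the points $(i,j)$ and $(i+1,j)$ ($0\le i<w-1$) are wired together perfectly at every second place: either exactly when $i+j$ is even, or exactly when $i+j$ is odd. If $l$ or $w$ is odd, these two patterns are mirror images of each other, so that there is only one hammock $H_{(l,w)}$ up to reflection; if $l$ and $w$ are both even, they give two different hammocks. Hammocks $H_{(l,w)}$ and $H_{(w,l)}$ are called dual to each other; when $l$ and $w$ are both even, it is required here that the two are built with opposite patterns (one with $i+j$ even, the other with $i+j$ odd). Let $h_{(l,w)}(p)$ be the reliability of $H_{(l,w)}$, that is, the probability that source and sink are connected when each device is closed with probability $p$, independently of the others. Suppose that $H_{(l,w)}$ and $H_{(w,l)}$ are dual hammocks and that their reliability polynomials are written in N-form (Bernstein basis): $$h_{(l,w)}(p)=\sum_{k=0}^{n}N_k\,p^k(1-p)^{n-k},\qquad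 h_{(w,l)}(p)=\sum_{k=0}^{n}N_k^{\perp}\,p^k(1-p)^{n-k}\qquad (p\in[0,1]).$$ Then $$\sum_{k=0}^{n}N_k+\sum_{k=0}^{n}N_k^{\perp}=2^n .$$ -/

import Mathlib

/-- A two-terminal network. The elements of `E` are the (unreliable) devices, the device `e`
joining the points `tail e` and `head e`. Two points `u`, `v` with `wire u v` are joined by a
perfect wire, that is, they form one and the same node of the network. -/
structure TwoTerminalNetwork (V E : Type) where
  tail : E → V
  head : E → V
  wire : V → V → Prop
  source : V
  sink : V

namespace TwoTerminalNetwork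

variable {V E : Type}

/-- The graph of all current connections when exactly the devices in `A` are closed. -/
def closedGraph (N : TwoTerminalNetwork V E) (A : Finset E) : SimpleGraph V :=
  SimpleGraph.fromRel fun u v => N.wire u v ∨ ∃ e ∈ A, N.tail e = u ∧ N.head e = v

/-- The two terminals are connected when exactly the devices in `A` are closed. -/
def Operates (N : TwoTerminalNetwork V E) (A : Finset E) : Prop :=
  (N.closedGraph A).Reachable N.source N.sink

open Classical in
/-- The reliability: the probability that the two terminals are connected when every device is
closed with probability `p`, independently of the others. -/
noncomputable def reliability [Fintype E] (N : TwoTerminalNetwork V E) (p : ℝ) : ℝ :=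
  ∑ A : Finset E with N.Operates A, p ^ A.card * (1 - p) ^ (Fintype.card E - A.card)

end TwoTerminalNetwork

/-- The hammock (brick-wall) network of length `l` and width `w`: there are `w` rows, each made of
`l` devices in series; the device `(i, j)` joins the points `(i, j)` and `(i, j + 1)` of row `i`.
All points of column `0` form the source and all points of column `l` form the sink. In the
interior columns `0 < j < l` the vertically neighbouring points `(i, j)` and `(i + 1, j)` are wired
together at every second place, in the brick-wall pattern: exactly when `i + j` is even
(for `ε = false`), or exactly when `i + j` is odd (for `ε = true`). -/
def hammock (l w : ℕ) [NeZero w] (ε : Bool) :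
    TwoTerminalNetwork (Fin w × Fin (l + 1)) (Fin w × Fin l) where
  tail e := (e.1, e.2.castSucc)
  head e := (e.1, e.2.succ)
  wire u v := u.1.val + 1 = v.1.val ∧ u.2 = v.2 ∧
    (u.2 = 0 ∨ u.2 = Fin.last l ∨ (u.1.val + u.2.val) % 2 = ε.toNat)
  source := (0, 0)
  sink := (0, Fin.last l)

/-- The hammocks of length `l`, width `w`, pattern `ε` and of length `w`, width `l`, pattern `δ`
are dual to each other. If `l` or `w` is odd, the two patterns are mirror images of each other, so
there is only one hammock of either shape, and the pattern does not matter. If `l` and `w` are both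
even, there are two different hammocks of either shape, and duality interchanges the patterns. -/
def AreDualHammocks (l w : ℕ) (ε δ : Bool) : Prop :=
  Even l → Even w → ε ≠ δ

/-!
At `p = 1 / 2` every set of closed devices has weight `2⁻ⁿ`, so the sum of the coefficients of the
N-form is the number of operating sets of devices. The theorem thus says that the operating sets of
two dual hammocks number `2 ^ n` together.

If the patterns are opposite, this is planar duality: device `(i, j)` of the first hammock
corresponds to device `(j, i)` of the second, and a set `A` operates in the first hammock if and only
if the devices corresponding to the complement of `A` do not operate in the second
(`hammock_operates_iff`). The proof is linear algebra on potentials, that is, integer functions on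
the points that agree along wires.

* The two networks cannot both operate (`not_operates_dual`). A path through the second hammock carries a
  unit flow `q` supported on its closed devices (`exists_flow`). The partial row sums of `q` in the
  first hammock form a potential there: equality along a wire is conservation of `q` at a node, or
  at several nodes, of the second hammock. This potential is constant along the devices in `A`, but
  rises by `1` from source to sink.
* At least one of them operates (`operates_or_operates_dual`). Otherwise both networks have cuts, given by
  potentials `f` and `g` that are constant along closed devices and rise by `1`. The sum over all
  devices of the product of the increments of `f` and `g` vanishes termwise, but two summations by
  parts show that it is `1` (`sum_mul_increments_eq_one`).

If the patterns are equal, then `l` or `w` is odd, and a reflection of the first hammock exchanges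
its patterns without changing the number of operating sets (`numOperating_not`).
-/

namespace TwoTerminalNetwork

variable {V E : Type}

/-! ### Potentials, cuts and flows -/

/-- A potential on the points of a network takes equal values on points joined by a wire, that is,
it is a function on the nodes. -/
def IsPotential (N : TwoTerminalNetwork V E) (f : V → ℤ) : Prop :=
  ∀ u v, N.wire u v → f u = f v

theorem Operates.potential_eq {N : TwoTerminalNetwork V E} {A : Finset E} (h : N.Operates A)
    {f : V → ℤ} (hf : N.IsPotential f) (hA : ∀ e ∈ A, f (N.tail e) = f (N.head e)) :
    f N.source = f N.sink := by
  unfold Operates at h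
  generalize N.source = s, N.sink = t at h ⊢
  obtain ⟨p⟩ := h
  induction p with
  | nil => rfl
  | cons hadj _ ih =>
    refine Eq.trans ?_ ih
    rcases hadj with ⟨-, (h | ⟨e, he, rfl, rfl⟩) | (h | ⟨e, he, rfl, rfl⟩)⟩
    · exact hf _ _ h
    · exact hA e he
    · exact (hf _ _ h).symm
    · exact (hA e he).symm

/-- If the terminals are not connected, the indicator function of the points not reachable from
the source is a potential exhibiting a cut. -/
theorem exists_cut {N : TwoTerminalNetwork V E} {A : Finset E} (h : ¬ N.Operates A) :
    ∃ f : V → ℤ, N.IsPotential f ∧ (∀ e ∈ A, f (N.tail e) = f (N.head e)) ∧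
      f N.source = 0 ∧ f N.sink = 1 := by
  classical
  have key : ∀ u v, (N.wire u v ∨ ∃ e ∈ A, N.tail e = u ∧ N.head e = v) →
      ((N.closedGraph A).Reachable N.source u ↔ (N.closedGraph A).Reachable N.source v) := by
    intro u v huv
    by_cases hne : u = v
    · rw [hne]
    have hadj : (N.closedGraph A).Adj u v := ⟨hne, Or.inl huv⟩
    exact ⟨fun h => h.trans hadj.reachable, fun h => h.trans hadj.symm.reachable⟩
  refine ⟨fun v => if (N.closedGraph A).Reachable N.source v then 0 else 1, ?_, ?_, ?_, ?_⟩
  · intro u v huv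
    simp only [key u v (Or.inl huv)]
  · intro e he
    simp only [key _ _ (Or.inr ⟨e, he, rfl, rfl⟩)]
  · simp
  · exact if_neg h

/-- A path from source to sink carries a unit flow on the closed devices. Conservation of the flow
at the nodes is expressed by pairing it with the increments of an arbitrary potential. -/
theorem exists_flow [Fintype E] {N : TwoTerminalNetwork V E} {A : Finset E} (h : N.Operates A) :
    ∃ q : E → ℤ, (∀ e ∉ A, q e = 0) ∧ ∀ f, N.IsPotential f →
      ∑ e, q e * (f (N.head e) - f (N.tail e)) = f N.sink - f N.source := by
  classical
  unfold Operates at h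
  generalize N.source = s, N.sink = t at h ⊢
  obtain ⟨p⟩ := h
  induction p with
  | nil => exact ⟨0, by simp, by simp⟩
  | @cons u v t hadj _ ih =>
    obtain ⟨q, hq, hflow⟩ := ih
    -- Adding the device `e` with sign `c` to the flow prolongs the path by one step.
    have step : ∀ e, ∀ c : ℤ, ∀ f, N.IsPotential f →
        ∑ x, (q x + if x = e then c else 0) * (f (N.head x) - f (N.tail x)) =
          f t - f v + c * (f (N.head e) - f (N.tail e)) := by
      intro e c f hf
      simp only [add_mul, Finset.sum_add_distrib, hflow f hf, ite_mul, zero_mul,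
        Finset.sum_ite_eq', Finset.mem_univ, if_true]
    have supp : ∀ e ∈ A, ∀ c : ℤ, ∀ x ∉ A, (q x + if x = e then c else 0) = 0 := by
      intro e he c x hx
      rw [hq x hx, if_neg (ne_of_mem_of_not_mem he hx).symm, add_zero]
    rcases hadj with ⟨-, (h | ⟨e, he, rfl, rfl⟩) | (h | ⟨e, he, rfl, rfl⟩)⟩
    · exact ⟨q, hq, fun f hf => by rw [hflow f hf, hf _ _ h]⟩
    · exact ⟨_, supp e he 1, fun f hf => by rw [step e 1 f hf]; ring⟩
    · exact ⟨q, hq, fun f hf => by rw [hflow f hf, hf _ _ h]⟩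
    · exact ⟨_, supp e he (-1), fun f hf => by rw [step e (-1) f hf]; ring⟩

/-! ### The number of operating sets -/

open Classical in
/-- The number of sets of devices that connect the terminals when they are closed. -/
noncomputable def numOperating [Fintype E] (N : TwoTerminalNetwork V E) : ℕ :=
  (Finset.univ.filter fun A : Finset E => N.Operates A).card

theorem reliability_half [Fintype E] (N : TwoTerminalNetwork V E) :
    N.reliability (1 / 2) = N.numOperating * (1 / 2) ^ Fintype.card E := by
  classical
  have h : ∀ A ∈ Finset.univ.filter (fun A : Finset E => N.Operates A),
      (1 / 2 : ℝ) ^ A.card * (1 - 1 / 2) ^ (Fintype.card E - A.card) =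
        (1 / 2) ^ Fintype.card E := by
    intro A _
    rw [show (1 - 1 / 2 : ℝ) = 1 / 2 by norm_num, ← pow_add,
      Nat.add_sub_cancel' A.card_le_univ]
  rw [reliability, numOperating, ← nsmul_eq_mul, ← Finset.sum_const]
  exact Finset.sum_congr (by congr) fun A hA => h A (by convert hA)

theorem sum_bernstein_coeff [Fintype E] (N : TwoTerminalNetwork V E) {n : ℕ}
    (hn : Fintype.card E = n) (c : ℕ → ℝ)
    (hc : ∀ p ∈ Set.Icc (0 : ℝ) 1,
      N.reliability p = ∑ k ∈ Finset.range (n + 1), c k * p ^ k * (1 - p) ^ (n - k)) :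
    ∑ k ∈ Finset.range (n + 1), c k = N.numOperating := by
  have h := hc (1 / 2) ⟨by norm_num, by norm_num⟩
  have hterm : ∀ k ∈ Finset.range (n + 1),
      c k * (1 / 2 : ℝ) ^ k * (1 - 1 / 2) ^ (n - k) = c k * (1 / 2) ^ n := by
    intro k hk
    rw [show (1 - 1 / 2 : ℝ) = 1 / 2 by norm_num, mul_assoc, ← pow_add,
      Nat.add_sub_cancel' (Nat.lt_succ_iff.mp (Finset.mem_range.mp hk))]
  rw [N.reliability_half, hn, Finset.sum_congr rfl hterm, ← Finset.sum_mul] at h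
  exact (mul_right_cancel₀ (by positivity) h).symm

end TwoTerminalNetwork

open TwoTerminalNetwork

/-! ### Potentials on a hammock -/

section Hammock

variable {l w : ℕ} [NeZero w] {ε : Bool} {f : Fin w × Fin (l + 1) → ℤ}

theorem TwoTerminalNetwork.IsPotential.eq_of_column (hf : (hammock l w ε).IsPotential f)
    {j : Fin (l + 1)} (hj : j = 0 ∨ j = Fin.last l) (i : Fin w) : f (i, j) = f (0, j) := by
  obtain ⟨i, hi⟩ := i
  induction i with
  | zero => rfl
  | succ i ih =>
    rw [← ih (by omega)]
    exact (hf (⟨i, by omega⟩, j) (⟨i + 1, hi⟩, j)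
      ⟨rfl, rfl, hj.elim Or.inl fun h => Or.inr (Or.inl h)⟩).symm

theorem TwoTerminalNetwork.IsPotential.eq_of_parity (hf : (hammock l w ε).IsPotential f)
    {i j : ℕ} (hi : i + 1 < w) (hj : j < l + 1) (h : (i + j) % 2 = ε.toNat) :
    f (⟨i, by omega⟩, ⟨j, hj⟩) = f (⟨i + 1, hi⟩, ⟨j, hj⟩) :=
  hf _ _ ⟨rfl, rfl, Or.inr (Or.inr h)⟩

/-! ### Reflections -/

/-- If `φ` and `ψ` map the points and the devices of one hammock to those of the other so that
potentials can be pulled back, then `ψ` preserves operating sets. -/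
theorem operates_map_of_pullback {ε' : Bool} (φ : Fin w × Fin (l + 1) → Fin w × Fin (l + 1))
    (ψ : Fin w × Fin l ↪ Fin w × Fin l)
    (hpot : ∀ f, (hammock l w ε').IsPotential f → (hammock l w ε).IsPotential (f ∘ φ))
    (hdev : ∀ (f : Fin w × Fin (l + 1) → ℤ) e,
      f ((ψ e).1, (ψ e).2.castSucc) = f ((ψ e).1, (ψ e).2.succ) →
        f (φ (e.1, e.2.castSucc)) = f (φ (e.1, e.2.succ)))
    (hterm : (φ (0, 0)).2 = 0 ∧ (φ (0, Fin.last l)).2 = Fin.last l ∨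
      (φ (0, 0)).2 = Fin.last l ∧ (φ (0, Fin.last l)).2 = 0)
    {A : Finset (Fin w × Fin l)} (h : (hammock l w ε).Operates A) :
    (hammock l w ε').Operates (A.map ψ) := by
  by_contra hn
  obtain ⟨f, hf, hfA, h0, h1⟩ := exists_cut hn
  have heq := h.potential_eq (hpot f hf)
    fun e he => hdev f e (hfA (ψ e) (Finset.mem_map_of_mem ψ he))
  change f (φ (0, 0)) = f (φ (0, Fin.last l)) at heq
  change f (0, 0) = 0 at h0
  change f (0, Fin.last l) = 1 at h1
  have hl : ∀ x : Fin w × Fin (l + 1), x.2 = 0 → f x = 0 := fun x hx => by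
    rw [← h0, ← hf.eq_of_column (Or.inl rfl) x.1, ← hx]
  have hr : ∀ x : Fin w × Fin (l + 1), x.2 = Fin.last l → f x = 1 := fun x hx => by
    rw [← h1, ← hf.eq_of_column (Or.inr rfl) x.1, ← hx]
  rcases hterm with ⟨ha, hb⟩ | ⟨ha, hb⟩
  · rw [hl _ ha, hr _ hb] at heq; exact absurd heq (by norm_num)
  · rw [hr _ ha, hl _ hb] at heq; exact absurd heq (by norm_num)

theorem exists_reflection (hodd : Odd l ∨ Odd w) (ε : Bool) :
    ∃ ψ : Fin w × Fin l ↪ Fin w × Fin l, ∀ A,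
      (hammock l w ε).Operates A → (hammock l w (!ε)).Operates (A.map ψ) := by
  have hε : (!ε).toNat = 1 - ε.toNat ∧ ε.toNat ≤ 1 := by cases ε <;> simp
  rcases hodd with ⟨k, hk⟩ | ⟨k, hk⟩
  · -- Left and right are exchanged, so tails become heads.
    refine ⟨((Equiv.refl _).prodCongr Fin.revPerm).toEmbedding, fun A hA =>
      operates_map_of_pullback (fun x => (x.1, x.2.rev)) _ ?_ ?_ ?_ hA⟩
    · rintro f hf ⟨i, j⟩ ⟨i', j'⟩ ⟨hi, rfl : j = j', hw⟩
      refine hf _ _ ⟨hi, rfl, ?_⟩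
      simp only [Fin.ext_iff, Fin.val_rev, Fin.val_last, Fin.val_zero] at hw ⊢
      have := j.isLt
      omega
    · intro f e h
      simpa [Fin.rev_castSucc, Fin.rev_succ] using h.symm
    · exact Or.inr ⟨by simp, by simp⟩
  · -- Upper and lower rows are exchanged, so the wires are reversed.
    refine ⟨(Fin.revPerm.prodCongr (Equiv.refl _)).toEmbedding, fun A hA =>
      operates_map_of_pullback (fun x => (x.1.rev, x.2)) _ ?_ ?_ ?_ hA⟩
    · rintro f hf ⟨i, j⟩ ⟨i', j'⟩ ⟨hi, rfl : j = j', hw⟩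
      have := i'.isLt
      simp only at hi
      refine (hf (i'.rev, j) (i.rev, j) ⟨?_, rfl, ?_⟩).symm
      · simp only [Fin.val_rev]
        omega
      · simp only [Fin.ext_iff, Fin.val_rev, Fin.val_last, Fin.val_zero] at hw ⊢
        omega
    · intro f e h
      simpa using h
    · exact Or.inl ⟨rfl, rfl⟩

theorem numOperating_le_not (hodd : Odd l ∨ Odd w) (ε : Bool) :
    (hammock l w ε).numOperating ≤ (hammock l w (!ε)).numOperating := by
  classical
  obtain ⟨ψ, hψ⟩ := exists_reflection hodd ε
  refine Finset.card_le_card_of_injOn (Finset.map ψ) ?_ (Finset.map_injective ψ).injOn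
  intro A hA
  simp only [Finset.coe_filter, Finset.mem_univ, true_and, Set.mem_ofPred_eq] at hA ⊢
  exact hψ A hA

theorem numOperating_not (hodd : Odd l ∨ Odd w) (ε : Bool) :
    (hammock l w (!ε)).numOperating = (hammock l w ε).numOperating :=
  le_antisymm (by simpa using numOperating_le_not hodd (!ε)) (numOperating_le_not hodd ε)

end Hammock

/-! ### Planar duality -/

/-- The devices of the dual hammock that are closed when exactly the devices in `A` are closed in
the original one: those crossing an open device. -/
def dualSet {l w : ℕ} (A : Finset (Fin w × Fin l)) : Finset (Fin l × Fin w) :=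
  Aᶜ.map (Equiv.prodComm _ _).toEmbedding

theorem mem_dualSet {l w : ℕ} {A : Finset (Fin w × Fin l)} {i : Fin w} {j : Fin l} :
    (j, i) ∈ dualSet A ↔ (i, j) ∉ A := by
  simp [dualSet]

theorem dualSet_bijective {l w : ℕ} :
    Function.Bijective (dualSet : Finset (Fin w × Fin l) → Finset (Fin l × Fin w)) :=
  (Equiv.finsetCongr (Equiv.prodComm _ _)).bijective.comp compl_involutive.bijective

/-- The intersection number of two crossing cuts is `1`. The values `F i j` and `G j i` are those of
potentials on two dual hammocks; at every inner crossing of the grid, one of them is continuous. -/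
theorem sum_mul_increments_eq_one {l w : ℕ} (hl : 0 < l) (hw : 0 < w) {F G : ℕ → ℕ → ℤ}
    (hF0 : ∀ i < w, F i 0 = 0) (hF1 : ∀ i < w, F i l = 1)
    (hG0 : ∀ j < l, G j 0 = 0) (hG1 : ∀ j < l, G j w = 1)
    (hFG : ∀ i j, i + 1 < w → j + 1 < l →
      F i (j + 1) = F (i + 1) (j + 1) ∨ G j (i + 1) = G (j + 1) (i + 1)) :
    ∑ i ∈ Finset.range w, ∑ j ∈ Finset.range l,
      (F i (j + 1) - F i j) * (G j (i + 1) - G j i) = 1 := by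
  obtain ⟨l, rfl⟩ := Nat.exists_eq_add_one.mpr hl
  obtain ⟨w, rfl⟩ := Nat.exists_eq_add_one.mpr hw
  -- Summation by parts along a line of crossings between two neighbouring rows.
  have hrow : ∀ i < w, ∀ m ≤ l, ∑ j ∈ Finset.range (m + 1),
      ((F i (j + 1) - F i j) - (F (i + 1) (j + 1) - F (i + 1) j)) * G j (i + 1) =
        (F i (m + 1) - F (i + 1) (m + 1)) * G m (i + 1) := by
    intro i hi m hm
    induction m with
    | zero => simp [hF0 i (by omega), hF0 (i + 1) (by omega)]
    | succ m ih =>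
      rw [Finset.sum_range_succ, ih (by omega)]
      rcases hFG i m (by omega) (by omega) with h | h <;> rw [h] <;> ring
  -- Summation by parts across the rows.
  have hcol : ∀ m ≤ w, ∑ i ∈ Finset.range (m + 1), ∑ j ∈ Finset.range (l + 1),
      (F i (j + 1) - F i j) * (G j (i + 1) - G j i) =
        ∑ j ∈ Finset.range (l + 1), (F m (j + 1) - F m j) * G j (m + 1) := by
    intro m hm
    induction m with
    | zero =>
      rw [Finset.sum_range_one]
      refine Finset.sum_congr rfl fun j hj => ?_
      rw [hG0 j (Finset.mem_range.mp hj), sub_zero]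
    | succ m ih =>
      have h := hrow m (by omega) l le_rfl
      rw [hF1 m (by omega), hF1 (m + 1) (by omega), sub_self, zero_mul] at h
      rw [Finset.sum_range_succ, ih (by omega), ← Finset.sum_add_distrib, ← sub_eq_zero,
        ← Finset.sum_sub_distrib, ← h]
      exact Finset.sum_congr rfl fun j _ => by ring
  rw [hcol w le_rfl, Finset.sum_congr rfl fun j hj => by
    rw [hG1 j (Finset.mem_range.mp hj), mul_one], Finset.sum_range_sub,
    hF1 w (by omega), hF0 w (by omega), sub_zero]

section Duality

variable {l w : ℕ} [NeZero l] [NeZero w] {ε δ : Bool}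

theorem operates_or_operates_dual (hne : ε ≠ δ) (A : Finset (Fin w × Fin l)) :
    (hammock l w ε).Operates A ∨ (hammock w l δ).Operates (dualSet A) := by
  by_contra! h
  obtain ⟨f, hf, hfA, hf0, hf1⟩ := exists_cut h.1
  obtain ⟨g, hg, hgA, hg0, hg1⟩ := exists_cut h.2
  change f (0, 0) = 0 at hf0
  change f (0, Fin.last l) = 1 at hf1
  change g (0, 0) = 0 at hg0
  change g (0, Fin.last w) = 1 at hg1
  have hparity : ∀ m, m % 2 = ε.toNat ∨ m % 2 = δ.toNat := by
    intro m
    have := Nat.mod_two_eq_zero_or_one m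
    cases ε <;> cases δ <;> simp_all
    omega
  -- The values of `f` and `g` for indices in `ℕ`; those out of range play no role.
  let F : ℕ → ℕ → ℤ := fun i j => f (Fin.ofNat w i, Fin.ofNat (l + 1) j)
  let G : ℕ → ℕ → ℤ := fun j i => g (Fin.ofNat l j, Fin.ofNat (w + 1) i)
  have hF : ∀ i j (hi : i < w) (hj : j < l + 1), F i j = f (⟨i, hi⟩, ⟨j, hj⟩) := by
    intro i j hi hj
    simp only [F, Fin.ofNat, Nat.mod_eq_of_lt hi, Nat.mod_eq_of_lt hj]
  have hG : ∀ j i (hj : j < l) (hi : i < w + 1), G j i = g (⟨j, hj⟩, ⟨i, hi⟩) := by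
    intro j i hj hi
    simp only [G, Fin.ofNat, Nat.mod_eq_of_lt hi, Nat.mod_eq_of_lt hj]
  have hsum := sum_mul_increments_eq_one (l := l) (w := w) (F := F) (G := G)
    (NeZero.pos l) (NeZero.pos w)
    (fun i hi => by
      rw [hF i 0 hi (by omega), ← hf0]; exact hf.eq_of_column (Or.inl rfl) _)
    (fun i hi => by
      rw [hF i l hi (by omega), ← hf1]; exact hf.eq_of_column (Or.inr rfl) _)
    (fun j hj => by
      rw [hG j 0 hj (by omega), ← hg0]; exact hg.eq_of_column (Or.inl rfl) _)
    (fun j hj => by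
      rw [hG j w hj (by omega), ← hg1]; exact hg.eq_of_column (Or.inr rfl) _)
    (fun i j hi hj => by
      rw [hF i _ (by omega) (by omega), hF _ _ hi (by omega), hG j _ (by omega) (by omega),
        hG _ _ hj (by omega)]
      rcases hparity (i + (j + 1)) with h | h
      · exact Or.inl (hf.eq_of_parity hi (by omega) h)
      · exact Or.inr (hg.eq_of_parity hj (by omega) (by rw [← h]; congr 1; omega)))
  rw [Finset.sum_eq_zero] at hsum
  · exact zero_ne_one hsum
  intro i hi
  refine Finset.sum_eq_zero fun j hj => ?_
  rw [Finset.mem_range] at hi hj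
  rw [hF i _ hi (by omega), hF i j hi (by omega), hG j _ hj (by omega), hG j i hj (by omega)]
  by_cases hmem : ((⟨i, hi⟩, ⟨j, hj⟩) : Fin w × Fin l) ∈ A
  · rw [show f (⟨i, hi⟩, ⟨j, _⟩) = f (⟨i, hi⟩, ⟨j + 1, _⟩) from hfA _ hmem, sub_self, zero_mul]
  · rw [show g (⟨j, hj⟩, ⟨i, _⟩) = g (⟨j, hj⟩, ⟨i + 1, _⟩) from hgA _ (mem_dualSet.mpr hmem),
      sub_self, mul_zero]

theorem not_operates_dual (hne : ε ≠ δ) {A : Finset (Fin w × Fin l)}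
    (hA : (hammock l w ε).Operates A) : ¬ (hammock w l δ).Operates (dualSet A) := by
  intro hB
  obtain ⟨q, hq, hflow⟩ := exists_flow hB
  have hflow' : ∀ g, (hammock w l δ).IsPotential g →
      ∑ j, ∑ i, q (j, i) * (g (j, i.succ) - g (j, i.castSucc)) =
        g (0, Fin.last w) - g (0, 0) := by
    intro g hg
    rw [← Fintype.sum_prod_type']
    exact hflow g hg
  -- The partial sums of the flow along the rows of the first hammock.
  let f : Fin w × Fin (l + 1) → ℤ := fun x =>
    ∑ j : Fin l, if j.val < x.2.val then q (j, x.1) else 0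
  have hf : (hammock l w ε).IsPotential f := by
    rintro ⟨i, b⟩ ⟨i', b'⟩ ⟨hi, rfl : b = b', hw⟩
    simp only at hi hw
    -- Conservation of the flow at the nodes between rows `i` and `i'` on the left of column `b`.
    have h := hflow' (fun x => if x.2.val = i'.val ∧ x.1.val < b.val then 1 else 0) (by
      rintro ⟨j, a⟩ ⟨j', a'⟩ ⟨hj, rfl : a = a', hwd⟩
      have h1 := i'.isLt
      have h2 := j'.isLt
      simp only [Fin.ext_iff, Fin.val_last, Fin.val_zero] at hj hw hwd ⊢
      have hne' : ε.toNat ≠ δ.toNat := by cases ε <;> cases δ <;> simp_all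
      congr 1
      apply propext
      omega)
    have hrhs : ¬ (w = i'.val ∧ 0 < b.val) ∧ ¬ (0 = i'.val ∧ 0 < b.val) := by
      have h1 := i'.isLt
      omega
    simp only [Fin.val_last, Fin.val_zero, Fin.val_succ, Fin.val_castSucc, hrhs.1, hrhs.2,
      if_false, sub_zero] at h
    rw [← sub_eq_zero, ← h, ← Finset.sum_sub_distrib]
    refine Finset.sum_congr rfl fun j _ => ?_
    by_cases hj : j.val < b.val
    · have e1 : ∀ x : Fin w, (x.val + 1 = i'.val) ↔ x = i := fun x => by rw [Fin.ext_iff]; omega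
      have e2 : ∀ x : Fin w, (x.val = i'.val) ↔ x = i' := fun x => by rw [Fin.ext_iff]
      simp [hj, e1, e2, mul_sub, Finset.sum_sub_distrib]
    · simp [hj]
  have hinc : ∀ e : Fin w × Fin l,
      f (e.1, e.2.succ) = f (e.1, e.2.castSucc) + q (e.2, e.1) := by
    rintro ⟨i, j⟩
    have hj : q (j, i) = ∑ x : Fin l, if x = j then q (x, i) else 0 := by simp
    simp only [f, Fin.val_succ, Fin.val_castSucc]
    rw [hj, ← Finset.sum_add_distrib]
    refine Finset.sum_congr rfl fun x _ => ?_
    rcases lt_trichotomy x.val j.val with h | h | h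
    · simp [h, Nat.lt_succ_of_lt h, Fin.ne_of_lt h]
    · simp [Fin.ext h]
    · simp [show ¬ x.val < j.val + 1 by omega, show ¬ x.val < j.val by omega,
        (Fin.ne_of_lt h).symm]
  have heq := hA.potential_eq hf (fun e he => by
    change f (e.1, e.2.castSucc) = f (e.1, e.2.succ)
    rw [hinc, hq _ (fun h => mem_dualSet.mp h he), add_zero])
  -- The flow out of the source of the second hammock is the full sum along row `0`.
  have htot := hflow' (fun x => if x.2.val = 0 then 0 else 1) (by
    rintro ⟨j, a⟩ ⟨j', a'⟩ ⟨-, rfl : a = a', -⟩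
    rfl)
  have e0 : ∀ x : Fin w, (x.val = 0) ↔ x = 0 := fun _ => Fin.val_eq_zero_iff
  have hwne : w ≠ 0 := NeZero.ne w
  have hrow : ∀ j : Fin l, ∑ i : Fin w, q (j, i) *
      ((if i.succ.val = 0 then 0 else 1) - (if i.castSucc.val = 0 then 0 else 1)) = q (j, 0) := by
    intro j
    rw [Finset.sum_eq_single 0]
    · simp [hwne]
    · intro i _ hi
      simp [e0, hi]
    · simp
  simp only [hrow, Fin.val_last, Fin.val_zero, if_neg hwne, if_true] at htot
  change f (0, 0) = f (0, Fin.last l) at heq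
  simp [f, htot] at heq

/-- Planar duality for hammocks of opposite patterns. -/
theorem hammock_operates_iff (hne : ε ≠ δ) (A : Finset (Fin w × Fin l)) :
    (hammock w l δ).Operates (dualSet A) ↔ ¬ (hammock l w ε).Operates A :=
  ⟨fun h h' => not_operates_dual hne h' h, (operates_or_operates_dual hne A).resolve_left⟩

theorem numOperating_add_numOperating (hne : ε ≠ δ) :
    (hammock l w ε).numOperating + (hammock w l δ).numOperating = 2 ^ (l * w) := by
  classical
  have h : (hammock w l δ).numOperating =
      (Finset.univ.filter fun A : Finset (Fin w × Fin l) =>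
        ¬ (hammock l w ε).Operates A).card := by
    symm
    refine Finset.card_bijective dualSet dualSet_bijective fun A => ?_
    simp only [Finset.mem_filter, Finset.mem_univ, true_and, hammock_operates_iff hne A]
  have hcard := Finset.card_filter_add_card_filter_not
    (s := (Finset.univ : Finset (Finset (Fin w × Fin l))))
    (fun A => (hammock l w ε).Operates A)
  rw [h, numOperating]
  convert hcard using 1
  simp [mul_comm]

end Duality

theorem mainTheorem1 (l w : ℕ) [NeZero l] [NeZero w] (ε δ : Bool)
    (hdual : AreDualHammocks l w ε δ) (n : ℕ) (hn : n = l * w) (N N' : ℕ → ℝ)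
    (hN : ∀ p ∈ Set.Icc (0 : ℝ) 1,
      (hammock l w ε).reliability p = ∑ k ∈ Finset.range (n + 1), N k * p ^ k * (1 - p) ^ (n - k))
    (hN' : ∀ p ∈ Set.Icc (0 : ℝ) 1,
      (hammock w l δ).reliability p =
        ∑ k ∈ Finset.range (n + 1), N' k * p ^ k * (1 - p) ^ (n - k)) :
    ∑ k ∈ Finset.range (n + 1), N k + ∑ k ∈ Finset.range (n + 1), N' k = 2 ^ n := by
  rw [sum_bernstein_coeff _ (by simp [hn, mul_comm]) N hN,
    sum_bernstein_coeff _ (by simp [hn]) N' hN', hn]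
  have hcount : (hammock l w ε).numOperating + (hammock w l δ).numOperating = 2 ^ (l * w) := by
    by_cases hne : ε = δ
    · have hodd : Odd l ∨ Odd w := by
        by_contra! h
        exact hdual (Nat.not_odd_iff_even.mp h.1) (Nat.not_odd_iff_even.mp h.2) hne
      rw [← numOperating_not hodd ε]
      exact numOperating_add_numOperating (by simp [hne])
    · exact numOperating_add_numOperating hne
  exact_mod_cast hcount
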